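/- Let $0<q<1$ and $\alpha>0$. **The quantum disc.** Let $\mathrm{Fun}(U)_q$ be the unital $*$-algebra over $\mathbb C$ generated by $z$, $z^*$ and $f_0=f_0^*$ with the relations $z^*z=q^2zz^*+1-q^2$, $f_0^2=f_0$, $z^*f_0=f_0z=0$, and let the space $D(U)_q$ of finite functions be its two-sided ideal generated by $f_0$. Let $T$ be the representation of $\mathrm{Fun}(U)_q$ in the vector space $H$ with basis $v_j$, $j\in\mathbb Z_+$, given by $T(z)v_j=v_{j+1}$, $T(z^*)v_j=(1-q^{2j})v_{j-1}$ (zero for $j=0$), $T(f_0)v_j=\delta_{j0}v_0$. It maps $D(U)_q$ one-to-one onto the operators whose matrices in this basis have finitely many nonzero entries. Distributions are identified, through $T$, with infinite matrices; in particular $(1-zz^*)^\lambda$, $\lambda\in\mathbb C$, is the operator $v_n\mapsto q^{2n\lambda}v_n$. For a finite function $f$ put $$\int_{U_q} f\,d\nu=(1-q^2)\,\mathrm{tr}\,T\big(f(1-zz^*)^{-1}\big),\qquad \int_{U_q} f\,d\nu_\alpha=\frac{1-q^{4\alpha}}{1-q^2}\int_{U_q} f(1-zz^*)^{2\alpha+1}d\nu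 .$$ Let $L^2_{q,\alpha}$ be the completion of $D(U)_q$ with respect to the scalar product $(f_1,f_2)_{q,\alpha}=\int_{U_q} f_2^*f_1\,d\nu_\alpha$. A vector $F\in L^2_{q,\alpha}$ is identified with an element $u\in\mathrm{Fun}(U)_q$ if $(F,g)_{q,\alpha}=\int_{U_q} g^*u\,d\nu_\alpha$ for all $g\in D(U)_q$; in this way $\mathbb C[z]\subset L^2_{q,\alpha}$. Let $P_{q,\alpha}$ be the orthogonal projection of $L^2_{q,\alpha}$ onto the closure $H^2_{q,\alpha}$ of $\mathbb C[z]$. **Proposition 1.5.** Let $f\in D(U)_q$. The Toeplitz–Bergman operator with symbol $f$, $$\widehat f:\mathbb C[z]\to\mathbb C[z],\qquad \widehat f\psi=P_{q,\alpha}(f\psi),$$ is well defined, i.e. there is exactly one linear operator $\widehat f$ in $\mathbb C[z]$ with this property. Let $\widehat f_{mj}$ be its matrix elements, $\widehat f z^j=\sum_{m}\widehat f_{mj}z^m$. Then for all $m,j\in\mathbb Z_+$ the product $P_{z,mj}f$ is a finite function and $$\widehat f_{mj}=\frac{1-q^{4\alpha}}{1-q^2}\int_{U_q}P_{z,mj}\,f\,d\nu,\qquad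 P_{z,mj}=\frac{(q^{4\alpha+2};q^2)_m}{(q^2;q^2)_m}\,q^{2j}z^j(1-zz^*)^{2\alpha+1}z^{*m},$$ where $(a;b)_m=\prod_{i=0}^{m-1}(1-ab^i)$. -/

import Mathlib

open Polynomial

namespace QuantumDisc

noncomputable section

/-! ### The `*`-algebra `Fun(U)_q` of functions in the quantum disc -/

/-- The generators `z`, `z*`, `f₀`. -/
inductive Gen
  | z
  | zs
  | f0

/-- The defining relations: `z* z = q² z z* + 1 - q²` (the relation of `Pol(ℂ)_q`), together with
`f₀² = f₀`, `z* f₀ = 0`, `f₀ z = 0`. -/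
inductive Rel (q : ℝ) : FreeAlgebra ℂ Gen → FreeAlgebra ℂ Gen → Prop
  | comm : Rel q (FreeAlgebra.ι ℂ Gen.zs * FreeAlgebra.ι ℂ Gen.z)
      (algebraMap ℂ _ ((q : ℂ) ^ 2) * (FreeAlgebra.ι ℂ Gen.z * FreeAlgebra.ι ℂ Gen.zs) +
        algebraMap ℂ _ (1 - (q : ℂ) ^ 2))
  | idem : Rel q (FreeAlgebra.ι ℂ Gen.f0 * FreeAlgebra.ι ℂ Gen.f0) (FreeAlgebra.ι ℂ Gen.f0)
  | left : Rel q (FreeAlgebra.ι ℂ Gen.zs * FreeAlgebra.ι ℂ Gen.f0) 0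
  | right : Rel q (FreeAlgebra.ι ℂ Gen.f0 * FreeAlgebra.ι ℂ Gen.z) 0

/-- The algebra `Fun(U)_q = Pol(ℂ)_q + D(U)_q`, by generators and relations. -/
def FunU (q : ℝ) : Type := RingQuot (Rel q)

instance (q : ℝ) : Ring (FunU q) := inferInstanceAs (Ring (RingQuot (Rel q)))

instance (q : ℝ) : Algebra ℂ (FunU q) := inferInstanceAs (Algebra ℂ (RingQuot (Rel q)))

/-- The quotient map from the free algebra. -/
def FunU.mk (q : ℝ) : FreeAlgebra ℂ Gen →ₐ[ℂ] FunU q := RingQuot.mkAlgHom ℂ (Rel q)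

/-- The generator `z` of `Fun(U)_q`. -/
def zElt (q : ℝ) : FunU q := FunU.mk q (FreeAlgebra.ι ℂ Gen.z)

/-- The generator `z*` of `Fun(U)_q`. -/
def zsElt (q : ℝ) : FunU q := FunU.mk q (FreeAlgebra.ι ℂ Gen.zs)

/-- The generator `f₀` of `Fun(U)_q`. -/
def f0Elt (q : ℝ) : FunU q := FunU.mk q (FreeAlgebra.ι ℂ Gen.f0)

theorem rel_comm (q : ℝ) : zsElt q * zElt q =
    algebraMap ℂ _ ((q : ℂ) ^ 2) * (zElt q * zsElt q) + algebraMap ℂ _ (1 - (q : ℂ) ^ 2) := by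
  have h := RingQuot.mkAlgHom_rel ℂ (Rel.comm (q := q))
  rw [map_add, map_mul, map_mul, map_mul, AlgHom.commutes, AlgHom.commutes] at h
  exact h

theorem rel_idem (q : ℝ) : f0Elt q * f0Elt q = f0Elt q := by
  have h := RingQuot.mkAlgHom_rel ℂ (Rel.idem (q := q))
  rw [map_mul] at h
  exact h

theorem rel_left (q : ℝ) : zsElt q * f0Elt q = 0 := by
  have h := RingQuot.mkAlgHom_rel ℂ (Rel.left (q := q))
  rw [map_mul, map_zero] at h
  exact h

theorem rel_right (q : ℝ) : f0Elt q * zElt q = 0 := by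
  have h := RingQuot.mkAlgHom_rel ℂ (Rel.right (q := q))
  rw [map_mul, map_zero] at h
  exact h

theorem FunU.induction {q : ℝ} {p : FunU q → Prop} (hs : ∀ c : ℂ, p (algebraMap ℂ _ c))
    (hz : p (zElt q)) (hzs : p (zsElt q)) (h0 : p (f0Elt q))
    (hm : ∀ a b, p a → p b → p (a * b)) (ha : ∀ a b, p a → p b → p (a + b)) (a : FunU q) :
    p a := by
  obtain ⟨x, rfl⟩ : ∃ x, FunU.mk q x = a := RingQuot.mkAlgHom_surjective ℂ (Rel q) a
  induction x using FreeAlgebra.induction with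
  | grade0 c => rw [AlgHom.commutes]; exact hs c
  | grade1 g => cases g <;> assumption
  | mul a b h1 h2 => rw [map_mul]; exact hm _ _ h1 h2
  | add a b h1 h2 => rw [map_add]; exact ha _ _ h1 h2

/-- The opposite algebra with conjugated scalars, used to define the antilinear involution. -/
@[reducible] def conjOpAlgebra (q : ℝ) : Algebra ℂ (FunU q)ᵐᵒᵖ :=
  ((algebraMap ℂ (FunU q)ᵐᵒᵖ).comp (starRingEnd ℂ)).toAlgebra' (fun c x => by
    simpa using Algebra.commutes (starRingEnd ℂ c) x)

/-- The values of the involution on the generators. -/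
def genStar (q : ℝ) : Gen → (FunU q)ᵐᵒᵖ
  | Gen.z => MulOpposite.op (zsElt q)
  | Gen.zs => MulOpposite.op (zElt q)
  | Gen.f0 => MulOpposite.op (f0Elt q)

/-- The involution as a map from the free algebra. -/
def starFree (q : ℝ) : FreeAlgebra ℂ Gen →+* (FunU q)ᵐᵒᵖ :=
  letI := conjOpAlgebra q
  (FreeAlgebra.lift ℂ (genStar q)).toRingHom

theorem starFree_ι (q : ℝ) (g : Gen) : starFree q (FreeAlgebra.ι ℂ g) = genStar q g :=
  letI := conjOpAlgebra q
  FreeAlgebra.lift_ι_apply (R := ℂ) (genStar q) g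

theorem starFree_algebraMap (q : ℝ) (c : ℂ) : starFree q (algebraMap ℂ _ c) =
    MulOpposite.op (algebraMap ℂ (FunU q) (starRingEnd ℂ c)) :=
  letI := conjOpAlgebra q
  (FreeAlgebra.lift ℂ (genStar q)).commutes c

theorem starFree_rel (q : ℝ) {x y : FreeAlgebra ℂ Gen} (h : Rel q x y) :
    starFree q x = starFree q y := by
  apply MulOpposite.unop_injective
  cases h with
  | comm =>
    simp only [map_add, map_mul, starFree_ι, starFree_algebraMap, genStar, MulOpposite.unop_mul,
      MulOpposite.unop_add, MulOpposite.unop_op, rel_comm]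
    have h1 : (starRingEnd ℂ) ((q : ℂ) ^ 2) = (q : ℂ) ^ 2 := by simp
    have h2 : (starRingEnd ℂ) (1 - (q : ℂ) ^ 2) = 1 - (q : ℂ) ^ 2 := by simp
    rw [h1, h2, Algebra.commutes]
  | idem => simp only [map_mul, starFree_ι, genStar, MulOpposite.unop_mul,
      MulOpposite.unop_op, rel_idem]
  | left => simp only [map_mul, starFree_ι, genStar, MulOpposite.unop_mul,
      MulOpposite.unop_op, rel_right, map_zero, MulOpposite.unop_zero]
  | right => simp only [map_mul, starFree_ι, genStar, MulOpposite.unop_mul,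
      MulOpposite.unop_op, rel_left, map_zero, MulOpposite.unop_zero]

/-- The involution of `Fun(U)_q` as a homomorphism to the opposite ring. -/
def starHom (q : ℝ) : FunU q →+* (FunU q)ᵐᵒᵖ :=
  RingQuot.lift ⟨starFree q, fun _ _ h => starFree_rel q h⟩

theorem starHom_mk (q : ℝ) (x : FreeAlgebra ℂ Gen) :
    starHom q (FunU.mk q x) = starFree q x := by
  have : FunU.mk q x = RingQuot.mkRingHom (Rel q) x := by
    rw [← RingQuot.mkAlgHom_coe ℂ (Rel q)]; rfl
  rw [this]
  exact RingQuot.lift_mkRingHom_apply _ _ _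

/-- The antilinear involution of `Fun(U)_q`: it exchanges `z` and `z*` and fixes `f₀`. -/
instance (q : ℝ) : Star (FunU q) := ⟨fun a => (starHom q a).unop⟩

theorem star_def {q : ℝ} (a : FunU q) : star a = (starHom q a).unop := rfl

theorem star_zElt (q : ℝ) : star (zElt q) = zsElt q := by
  rw [star_def, zElt, starHom_mk, starFree_ι]; rfl

theorem star_zsElt (q : ℝ) : star (zsElt q) = zElt q := by
  rw [star_def, zsElt, starHom_mk, starFree_ι]; rfl

theorem star_f0Elt (q : ℝ) : star (f0Elt q) = f0Elt q := by
  rw [star_def, f0Elt, starHom_mk, starFree_ι]; rfl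

theorem star_scalar (q : ℝ) (c : ℂ) :
    star (algebraMap ℂ (FunU q) c) = algebraMap ℂ (FunU q) (starRingEnd ℂ c) := by
  rw [← (FunU.mk q).commutes c, star_def, starHom_mk, starFree_algebraMap]; rfl

instance (q : ℝ) : StarRing (FunU q) where
  star_mul a b := by simp [star_def]
  star_add a b := by simp [star_def]
  star_involutive a := by
    have hmul : ∀ a b : FunU q, star (a * b) = star b * star a := fun a b => by simp [star_def]
    have hadd : ∀ a b : FunU q, star (a + b) = star a + star b := fun a b => by simp [star_def]
    induction a using FunU.induction with
    | hs c => rw [star_scalar, star_scalar, Complex.conj_conj]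
    | hz => rw [star_zElt, star_zsElt]
    | hzs => rw [star_zsElt, star_zElt]
    | h0 => rw [star_f0Elt, star_f0Elt]
    | hm a b h1 h2 => rw [hmul, hmul, h1, h2]
    | ha a b h1 h2 => rw [hadd, hadd, h1, h2]

instance (q : ℝ) : StarModule ℂ (FunU q) where
  star_smul c a := by
    rw [Algebra.smul_def, star_mul, star_scalar, ← Algebra.commutes, ← Algebra.smul_def]; rfl

/-- The space `D(U)_q` of finite functions: the two-sided ideal of `Fun(U)_q` generated by `f₀`. -/
def finiteFunctions (q : ℝ) : Submodule ℂ (FunU q) :=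
  Submodule.span ℂ {x | ∃ a b : FunU q, x = a * f0Elt q * b}

theorem mul_mem_left {q : ℝ} (a : FunU q) {f : FunU q} (hf : f ∈ finiteFunctions q) :
    a * f ∈ finiteFunctions q := by
  induction hf using Submodule.span_induction with
  | mem x hx =>
    obtain ⟨b, c, rfl⟩ := hx
    exact Submodule.subset_span ⟨a * b, c, by simp only [mul_assoc]⟩
  | zero => rw [mul_zero]; exact zero_mem _
  | add x y _ _ h1 h2 => rw [mul_add]; exact add_mem h1 h2
  | smul c x _ h => rw [mul_smul_comm]; exact Submodule.smul_mem _ _ h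

theorem mul_mem_right {q : ℝ} {f : FunU q} (hf : f ∈ finiteFunctions q) (a : FunU q) :
    f * a ∈ finiteFunctions q := by
  induction hf using Submodule.span_induction with
  | mem x hx =>
    obtain ⟨b, c, rfl⟩ := hx
    exact Submodule.subset_span ⟨b, c * a, by simp only [mul_assoc]⟩
  | zero => rw [zero_mul]; exact zero_mem _
  | add x y _ _ h1 h2 => rw [add_mul]; exact add_mem h1 h2
  | smul c x _ h => rw [smul_mul_assoc]; exact Submodule.smul_mem _ _ h

/-! ### The representation `T` in the space `H` with the basis `v_j` -/

/-- The vector space `H` with the basis `v_j`, `j ∈ ℤ₊`. -/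
abbrev H : Type := ℕ →₀ ℂ

/-- The basis vector `v_j`. -/
def v (j : ℕ) : H := Finsupp.single j 1

/-- The operator in `H` with prescribed values on the basis. -/
def opOfBasis (g : ℕ → H) : Module.End ℂ H := Finsupp.linearCombination ℂ g

theorem opOfBasis_v (g : ℕ → H) (j : ℕ) : opOfBasis g (v j) = g j := by
  simp [opOfBasis, v]

theorem op_ext {A B : Module.End ℂ H} (h : ∀ j, A (v j) = B (v j)) : A = B := by
  refine Finsupp.lhom_ext' fun j => LinearMap.ext_ring ?_
  exact h j

/-- Values of `T` on the generators:
`T(z) v_j = v_{j+1}`, `T(z*) v_j = (1 - q^{2j}) v_{j-1}` (zero for `j = 0`),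
`T(f₀) v_j = δ_{j0} v_0`. -/
def genT (q : ℝ) : Gen → Module.End ℂ H
  | Gen.z => opOfBasis fun j => v (j + 1)
  | Gen.zs => opOfBasis fun j => (1 - (q : ℂ) ^ (2 * j)) • v (j - 1)
  | Gen.f0 => opOfBasis fun j => if j = 0 then v 0 else 0

theorem genT_rel (q : ℝ) {x y : FreeAlgebra ℂ Gen} (h : Rel q x y) :
    FreeAlgebra.lift ℂ (genT q) x = FreeAlgebra.lift ℂ (genT q) y := by
  refine op_ext fun j => ?_
  cases h with
  | comm =>
    simp only [map_add, map_mul, FreeAlgebra.lift_ι_apply, AlgHom.commutes, genT,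
      Module.End.mul_apply, LinearMap.add_apply, opOfBasis_v, Module.algebraMap_end_apply,
      map_smul, add_tsub_cancel_right]
    rcases j with _ | j
    · simp
    · simp only [Nat.add_sub_cancel, smul_smul, ← add_smul]
      congr 1
      ring
  | idem =>
    simp only [map_mul, FreeAlgebra.lift_ι_apply, genT, Module.End.mul_apply, opOfBasis_v]
    split_ifs <;> simp [opOfBasis_v]
  | left =>
    simp only [map_mul, FreeAlgebra.lift_ι_apply, genT, Module.End.mul_apply, opOfBasis_v]
    split_ifs <;> simp [opOfBasis_v]
  | right =>
    simp [FreeAlgebra.lift_ι_apply, genT, Module.End.mul_apply, opOfBasis_v]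

/-- The representation `T` of `Fun(U)_q` in `H`. -/
def T (q : ℝ) : FunU q →ₐ[ℂ] Module.End ℂ H :=
  RingQuot.liftAlgHom ℂ ⟨FreeAlgebra.lift ℂ (genT q), fun _ _ h => genT_rel q h⟩

theorem T_mk (q : ℝ) (x : FreeAlgebra ℂ Gen) :
    T q (FunU.mk q x) = FreeAlgebra.lift ℂ (genT q) x :=
  RingQuot.liftAlgHom_mkAlgHom_apply _ _ _ _

theorem T_zElt (q : ℝ) (j : ℕ) : T q (zElt q) (v j) = v (j + 1) := by
  rw [zElt, T_mk, FreeAlgebra.lift_ι_apply, genT, opOfBasis_v]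

theorem T_zsElt (q : ℝ) (j : ℕ) :
    T q (zsElt q) (v j) = (1 - (q : ℂ) ^ (2 * j)) • v (j - 1) := by
  rw [zsElt, T_mk, FreeAlgebra.lift_ι_apply, genT, opOfBasis_v]

theorem T_f0Elt (q : ℝ) (j : ℕ) : T q (f0Elt q) (v j) = if j = 0 then v 0 else 0 := by
  rw [f0Elt, T_mk, FreeAlgebra.lift_ι_apply, genT, opOfBasis_v]

/-! ### Distributions, powers of `1 - z z*`, invariant integral

Through `T`, a distribution is a linear operator from `H` to formal series in the `v_j` (an infinite
matrix). All distributions used below map `H` to itself, so that they are written as elements of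
`Module.End ℂ H`, and their products with `T f` are products of operators. -/

/-- The distribution `(1 - z z*)^l = ∑_n q^{2nl} f_n`, where `T(f_n) v_k = δ_{nk} v_k`. -/
def yPow (q : ℝ) (l : ℂ) : Module.End ℂ H :=
  opOfBasis fun n => ((q : ℂ) ^ (2 * (n : ℂ) * l)) • v n

theorem yPow_one (q : ℝ) : yPow q 1 = T q (1 - zElt q * zsElt q) := by
  refine op_ext fun j => ?_
  rw [yPow, opOfBasis_v, map_sub, map_mul, map_one, LinearMap.sub_apply, Module.End.mul_apply,
    T_zsElt, map_smul, T_zElt, Module.End.one_apply]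
  have : (q : ℂ) ^ (2 * (j : ℂ) * 1) = (q : ℂ) ^ (2 * j) := by
    rw [← Complex.cpow_natCast]; push_cast; ring_nf
  rw [this]
  rcases j with _ | j
  · simp
  · rw [Nat.add_sub_cancel, sub_smul, one_smul, sub_sub_cancel]

/-- Trace of an operator whose matrix in the basis `v_j` has finitely many nonzero entries. -/
def tr (A : Module.End ℂ H) : ℂ := ∑ᶠ k, A (v k) k

/-- The invariant integral `∫ f dν = (1 - q²) tr T(f (1 - z z*)⁻¹)`, as a functional of the
operator `A = T f` (a finite matrix). -/
def nuInt (q : ℝ) (A : Module.End ℂ H) : ℂ := (1 - (q : ℂ) ^ 2) * tr (A * yPow q (-1))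

/-- `∫ f dν_α = (1 - q^{4α})/(1 - q²) ∫ f (1 - z z*)^{2α+1} dν`, as a functional of `T f`. -/
def nuAlphaInt (q α : ℝ) (A : Module.End ℂ H) : ℂ :=
  (((1 - q ^ (4 * α)) / (1 - q ^ 2) : ℝ) : ℂ) * nuInt q (A * yPow q ((2 * α + 1 : ℝ) : ℂ))

/-! ### `T` is a `*`-representation; positivity -/

/-- The squared length of `v_i` in the pre-Hilbert space `H`. -/
def wt (q : ℝ) (i : ℕ) : ℝ := ∏ k ∈ Finset.range i, (1 - q ^ (2 * (k + 1)))

theorem wt_succ (q : ℝ) (i : ℕ) : wt q (i + 1) = wt q i * (1 - q ^ (2 * (i + 1))) := by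
  rw [wt, wt, Finset.prod_range_succ]

theorem wt_pos {q : ℝ} (hq : q ∈ Set.Ioo (0 : ℝ) 1) (i : ℕ) : 0 < wt q i :=
  Finset.prod_pos fun k _ => sub_pos.2 (pow_lt_one₀ hq.1.le hq.2 (by omega))

/-- The scalar product of `H`. -/
def form (q : ℝ) (u w : H) : ℂ := ∑ᶠ i, (wt q i : ℂ) * (starRingEnd ℂ (u i) * w i)

theorem conj_finsum (F : ℕ → ℂ) : starRingEnd ℂ (∑ᶠ i, F i) = ∑ᶠ i, starRingEnd ℂ (F i) :=
  AddMonoidHom.map_finsum_of_injective (starRingEnd ℂ).toAddMonoidHom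
    (starRingEnd ℂ).injective _

theorem form_supp (q : ℝ) (u w : H) :
    (Function.support fun i => (wt q i : ℂ) * (starRingEnd ℂ (u i) * w i)).Finite := by
  refine w.support.finite_toSet.subset fun i hi => ?_
  simp only [Function.mem_support] at hi
  simp only [SetLike.mem_coe, Finsupp.mem_support_iff]
  intro h
  simp [h] at hi

theorem form_add_right (q : ℝ) (u w x : H) : form q u (w + x) = form q u w + form q u x := by
  rw [form, form, form, ← finsum_add_distrib (form_supp q u w) (form_supp q u x)]
  exact finsum_congr fun i => by simp only [Finsupp.add_apply]; ring

theorem form_smul_right (q : ℝ) (u w : H) (c : ℂ) : form q u (c • w) = c * form q u w := by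
  rw [form, form, mul_finsum' _ _ (form_supp q u w)]
  exact finsum_congr fun i => by simp only [Finsupp.smul_apply, smul_eq_mul]; ring

theorem form_conj (q : ℝ) (u w : H) : starRingEnd ℂ (form q u w) = form q w u := by
  rw [form, form, conj_finsum]
  exact finsum_congr fun i => by
    simp only [map_mul, Complex.conj_ofReal, Complex.conj_conj]; ring

theorem form_add_left (q : ℝ) (u w x : H) : form q (u + w) x = form q u x + form q w x := by
  rw [← form_conj, form_add_right, map_add, form_conj, form_conj]

theorem form_smul_left (q : ℝ) (u w : H) (c : ℂ) :
    form q (c • u) w = starRingEnd ℂ c * form q u w := by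
  rw [← form_conj, form_smul_right, map_mul, form_conj]

theorem form_zero_right (q : ℝ) (u : H) : form q u 0 = 0 := by
  simpa using form_smul_right q u 0 0

theorem form_v_left (q : ℝ) (k : ℕ) (u : H) : form q (v k) u = wt q k * u k := by
  rw [form, finsum_eq_single _ k]
  · simp [v]
  · intro i hi
    simp [v, hi.symm]

theorem form_self_nonneg {q : ℝ} (hq : q ∈ Set.Ioo (0 : ℝ) 1) (u : H) :
    ∃ r : ℝ, 0 ≤ r ∧ form q u u = r := by
  refine ⟨∑ i ∈ u.support, wt q i * Complex.normSq (u i), Finset.sum_nonneg fun i _ =>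
    mul_nonneg (wt_pos hq i).le (Complex.normSq_nonneg _), ?_⟩
  rw [form, finsum_eq_sum_of_support_subset (s := u.support)]
  · push_cast
    exact Finset.sum_congr rfl fun i _ => by rw [Complex.normSq_eq_conj_mul_self]
  · intro i hi
    simp only [Function.mem_support] at hi
    simp only [SetLike.mem_coe, Finsupp.mem_support_iff]
    intro h
    simp [h] at hi

theorem form_adjoint_of_basis {q : ℝ} {A B : Module.End ℂ H}
    (h : ∀ i k, form q (A (v i)) (v k) = form q (v i) (B (v k))) (u w : H) :
    form q (A u) w = form q u (B w) := by
  have hs : ∀ (i : ℕ) (c : ℂ), (Finsupp.single i c : H) = c • v i := fun i c => by simp [v]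
  induction u using Finsupp.induction_linear with
  | zero => rw [map_zero, ← form_conj, form_zero_right, ← form_conj q _ (0 : H), form_zero_right]
  | add u u' h1 h2 => rw [map_add, form_add_left, form_add_left, h1, h2]
  | single i c =>
    rw [hs, map_smul, form_smul_left, form_smul_left]
    congr 1
    induction w using Finsupp.induction_linear with
    | zero => rw [map_zero, form_zero_right, form_zero_right]
    | add u u' h1 h2 => rw [map_add, form_add_right, form_add_right, h1, h2]
    | single k d => rw [hs, map_smul, form_smul_right, form_smul_right, h]

theorem T_zs_adjoint (q : ℝ) (u w : H) :
    form q (T q (zsElt q) u) w = form q u (T q (zElt q) w) := by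
  refine form_adjoint_of_basis (fun i k => ?_) u w
  rw [T_zsElt, T_zElt, form_smul_left, form_v_left, form_v_left]
  rcases i with _ | i
  · simp [v]
  · by_cases h : k = i
    · subst h
      rw [wt_succ]
      simp [v]
      ring
    · simp [v, h]

/-- `T` is a `*`-representation. -/
theorem T_star (q : ℝ) (a : FunU q) :
    ∀ u w : H, form q (T q (star a) u) w = form q u (T q a w) := by
  induction a using FunU.induction with
  | hs c =>
    intro u w
    rw [star_scalar, AlgHom.commutes, AlgHom.commutes, Module.algebraMap_end_apply,
      Module.algebraMap_end_apply, form_smul_left, form_smul_right, Complex.conj_conj]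
  | hz => rw [star_zElt]; exact T_zs_adjoint q
  | hzs =>
    intro u w
    rw [star_zsElt, ← form_conj, ← T_zs_adjoint, form_conj]
  | h0 =>
    rw [star_f0Elt]
    refine form_adjoint_of_basis fun i k => ?_
    rw [T_f0Elt, T_f0Elt]
    split_ifs with h1 h2 h2
    · rw [h1, h2]
    · rw [form_zero_right, form_v_left]; simp [v, h2]
    · rw [← form_conj, form_zero_right, form_v_left]; simp [v, Ne.symm h1]
    · rw [← form_conj, form_zero_right, form_zero_right]; simp
  | hm a b h1 h2 =>
    intro u w
    rw [star_mul, map_mul, map_mul, Module.End.mul_apply, Module.End.mul_apply, h2, h1]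
  | ha a b h1 h2 =>
    intro u w
    rw [star_add, map_add, map_add, LinearMap.add_apply, LinearMap.add_apply, form_add_left,
      form_add_right, h1, h2]

/-- Finite functions annihilate all but finitely many `v_k`. -/
theorem finite_of_mem {q : ℝ} (hq : q ∈ Set.Ioo (0 : ℝ) 1) {f : FunU q}
    (hf : f ∈ finiteFunctions q) : {k | T q f (v k) ≠ 0}.Finite := by
  induction hf using Submodule.span_induction with
  | mem x hx =>
    obtain ⟨a, b, rfl⟩ := hx
    refine (T q (star b) (v 0)).support.finite_toSet.subset fun k hk => ?_
    simp only [SetLike.mem_coe, Finsupp.mem_support_iff]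
    intro h
    apply hk
    have h0 : T q b (v k) 0 = 0 := by
      have h1 := T_star q b (v 0) (v k)
      rw [← form_conj, form_v_left, form_v_left, h] at h1
      have := wt_pos hq 0
      simpa [this.ne'] using h1.symm
    have hz : ∀ u : H, T q (f0Elt q) u = u 0 • v 0 := by
      intro u
      induction u using Finsupp.induction_linear with
      | zero => simp
      | add u w h1 h2 => rw [map_add, h1, h2, Finsupp.add_apply, add_smul]
      | single i c =>
        have : (Finsupp.single i c : H) = c • v i := by simp [v]
        rw [this, map_smul, T_f0Elt]
        split_ifs with h <;> simp [v, h]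
    rw [map_mul, map_mul, Module.End.mul_apply, Module.End.mul_apply, hz, h0, zero_smul, map_zero]
  | zero => simp
  | add x y _ _ h1 h2 =>
    refine (h1.union h2).subset fun k hk => ?_
    by_contra h
    simp only [Set.mem_union, Set.mem_ofPred_eq, not_or, not_not] at h
    exact hk (by rw [map_add, LinearMap.add_apply, h.1, h.2, add_zero])
  | smul c x _ h =>
    refine h.subset fun k hk hk2 => hk ?_
    rw [map_smul, LinearMap.smul_apply, hk2, smul_zero]

/-! ### The Hilbert space `L²_{q,α}` -/

/-- The vector space `D(U)_q`, to be equipped with the scalar product depending on `α`. -/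
def PreL2 (q _α : ℝ) : Type := finiteFunctions q

instance (q α : ℝ) : AddCommGroup (PreL2 q α) := inferInstanceAs (AddCommGroup (finiteFunctions q))

instance (q α : ℝ) : Module ℂ (PreL2 q α) := inferInstanceAs (Module ℂ (finiteFunctions q))

/-- The underlying element of `Fun(U)_q`. -/
def PreL2.val {q α : ℝ} : PreL2 q α →ₗ[ℂ] FunU q := (finiteFunctions q).subtype

theorem PreL2.mem {q α : ℝ} (f : PreL2 q α) : f.val ∈ finiteFunctions q := Subtype.property f

/-- A finite function regarded as a vector of the pre-Hilbert space. -/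
def PreL2.mk {q : ℝ} (α : ℝ) (f : FunU q) (hf : f ∈ finiteFunctions q) : PreL2 q α := ⟨f, hf⟩

theorem nuAlphaInt_eq {q : ℝ} (hq : q ∈ Set.Ioo (0 : ℝ) 1) (α : ℝ) (A : Module.End ℂ H) :
    nuAlphaInt q α A =
      ((1 - q ^ (4 * α) : ℝ) : ℂ) * ∑ᶠ k : ℕ, ((q ^ (4 * α * k) : ℝ) : ℂ) * A (v k) k := by
  have h1 : (1 - q ^ 2 : ℝ) ≠ 0 := (sub_pos.2 (pow_lt_one₀ hq.1.le hq.2 two_ne_zero)).ne'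
  have h2 : (((1 - q ^ 2 : ℝ) : ℂ)) ≠ 0 := by exact_mod_cast h1
  have h3 : (1 - (q : ℂ) ^ 2) = ((1 - q ^ 2 : ℝ) : ℂ) := by push_cast; rfl
  rw [nuAlphaInt, nuInt, h3, ← mul_assoc, Complex.ofReal_div, div_mul_cancel₀ _ h2, tr]
  congr 1
  refine finsum_congr fun k => ?_
  have hy : ∀ l : ℂ, yPow q l (v k) = ((q : ℂ) ^ (2 * (k : ℂ) * l)) • v k := fun l => by
    rw [yPow, opOfBasis_v]
  rw [Module.End.mul_apply, Module.End.mul_apply, hy, map_smul, hy,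
    map_smul, map_smul, smul_smul, Finsupp.smul_apply, smul_eq_mul]
  congr 1
  have h4 : (q : ℂ) ≠ 0 := by exact_mod_cast hq.1.ne'
  rw [← Complex.cpow_add _ _ h4, Complex.ofReal_cpow hq.1.le]
  congr 1
  push_cast
  ring

/-- The scalar product `∫ f* g dν_α`, in terms of the scalar product of `H`. -/
theorem nuAlphaInt_star_mul {q : ℝ} (hq : q ∈ Set.Ioo (0 : ℝ) 1) (α : ℝ) (f g : FunU q) :
    nuAlphaInt q α (T q (star f * g)) = ((1 - q ^ (4 * α) : ℝ) : ℂ) * ∑ᶠ k : ℕ,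
      ((q ^ (4 * α * k) / wt q k : ℝ) : ℂ) * form q (T q f (v k)) (T q g (v k)) := by
  rw [nuAlphaInt_eq hq]
  congr 1
  refine finsum_congr fun k => ?_
  have hw : ((wt q k : ℝ) : ℂ) ≠ 0 := by exact_mod_cast (wt_pos hq k).ne'
  have h := T_star q (star f) (v k) (T q g (v k))
  rw [star_star] at h
  rw [h, form_v_left, map_mul, Module.End.mul_apply, Complex.ofReal_div]
  field_simp

/-- The pre-Hilbert structure of `D(U)_q`. In the convention of Mathlib (linear in the second
argument) `⟪f, g⟫ = ∫ f* g dν_α`. -/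
@[reducible] def preL2Core (q α : ℝ) (hq : q ∈ Set.Ioo (0 : ℝ) 1) (hα : 0 < α) :
    PreInnerProductSpace.Core ℂ (PreL2 q α) where
  inner f g := nuAlphaInt q α (T q (star f.val * g.val))
  conj_inner_symm f g := by
    change starRingEnd ℂ (nuAlphaInt q α (T q (star g.val * f.val))) = _
    rw [nuAlphaInt_star_mul hq, nuAlphaInt_star_mul hq, map_mul, Complex.conj_ofReal,
      conj_finsum]
    congr 1
    exact finsum_congr fun k => by rw [map_mul, Complex.conj_ofReal, form_conj]
  re_inner_nonneg f := by
    rw [nuAlphaInt_star_mul hq]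
    choose r hr0 hr using fun k : ℕ => form_self_nonneg hq (T q f.val (v k))
    simp only [hr]
    have : ∀ k : ℕ, ((q ^ (4 * α * k) / wt q k : ℝ) : ℂ) * (r k : ℂ) =
        ((q ^ (4 * α * k) / wt q k * r k : ℝ) : ℂ) := fun k => by push_cast; ring
    simp only [this]
    have hpos : ∀ k : ℕ, 0 ≤ q ^ (4 * α * k) / wt q k * r k := fun k =>
      mul_nonneg (div_nonneg (Real.rpow_nonneg hq.1.le _) (wt_pos hq k).le) (hr0 k)
    have hfin : (∑ᶠ k : ℕ, ((q ^ (4 * α * k) / wt q k * r k : ℝ) : ℂ)) =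
        ((∑ᶠ k : ℕ, (q ^ (4 * α * k) / wt q k * r k) : ℝ) : ℂ) :=
      (AddMonoidHom.map_finsum_of_injective Complex.ofRealHom.toAddMonoidHom
        Complex.ofReal_injective _).symm
    rw [hfin, ← Complex.ofReal_mul]
    refine mul_nonneg (sub_nonneg.2 ?_) (finsum_nonneg hpos)
    exact Real.rpow_le_one hq.1.le hq.2.le (by positivity)
  add_left f g h := by
    change nuAlphaInt q α (T q (star (f + g).val * h.val)) =
      nuAlphaInt q α (T q (star f.val * h.val)) + nuAlphaInt q α (T q (star g.val * h.val))
    rw [nuAlphaInt_eq hq, nuAlphaInt_eq hq, nuAlphaInt_eq hq, ← mul_add, ← finsum_add_distrib]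
    · congr 1
      refine finsum_congr fun k => ?_
      rw [map_add, star_add, add_mul, map_add, LinearMap.add_apply, Finsupp.add_apply, mul_add]
    · refine (finite_of_mem hq h.mem).subset fun k hk hh => hk ?_
      simp only [map_mul, Module.End.mul_apply, hh, map_zero, Finsupp.zero_apply, mul_zero]
    · refine (finite_of_mem hq h.mem).subset fun k hk hh => hk ?_
      simp only [map_mul, Module.End.mul_apply, hh, map_zero, Finsupp.zero_apply, mul_zero]
  smul_left f g c := by
    change nuAlphaInt q α (T q (star (c • f).val * g.val)) =
      starRingEnd ℂ c * nuAlphaInt q α (T q (star f.val * g.val))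
    rw [nuAlphaInt_eq hq, nuAlphaInt_eq hq, mul_left_comm, mul_finsum' _ (starRingEnd ℂ c)]
    · congr 1
      refine finsum_congr fun k => ?_
      rw [map_smul, star_smul, smul_mul_assoc, map_smul, LinearMap.smul_apply,
        Finsupp.smul_apply, smul_eq_mul, mul_left_comm]
      rfl
    · refine (finite_of_mem hq g.mem).subset fun k hk hh => hk ?_
      simp only [map_mul, Module.End.mul_apply, hh, map_zero, Finsupp.zero_apply, mul_zero]

section Hilbert

variable (q α : ℝ) [hq : Fact (q ∈ Set.Ioo (0 : ℝ) 1)] [hα : Fact (0 < α)]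

instance : SeminormedAddCommGroup (PreL2 q α) :=
  letI := preL2Core q α hq.out hα.out
  InnerProductSpace.Core.toSeminormedAddCommGroup (𝕜 := ℂ)

instance : InnerProductSpace ℂ (PreL2 q α) :=
  InnerProductSpace.ofCore (preL2Core q α hq.out hα.out)

/-- The Hilbert space `L²_{q,α}`: the completion of `D(U)_q`. -/
abbrev L2 : Type := UniformSpace.Completion (PreL2 q α)

variable {q}

/-- The vector `F` of `L²_{q,α}` is the function `u`, under the embedding of `L²_{q,α}` in the space
of distributions given by `F ↦ (g ↦ ⟪g, F⟫)`: for every finite `g` one has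
`⟪g, F⟫ = ∫ g* u dν_α` (here `g* u` is again a finite function). -/
def Represents (F : L2 q α) (u : FunU q) : Prop :=
  ∀ g : PreL2 q α, inner ℂ (g : L2 q α) F = nuAlphaInt q α (T q (star g.val * u))

/-- A polynomial `ψ ∈ ℂ[z]` as an element of `Fun(U)_q`. -/
def poly (ψ : ℂ[X]) : FunU q := aeval (zElt q) ψ

variable (q)

/-- `H²_{q,α}`: the closure in `L²_{q,α}` of the space of polynomials in `z`. -/
def H2 : Submodule ℂ (L2 q α) :=
  (Submodule.span ℂ {F : L2 q α | ∃ ψ : ℂ[X], Represents α F (poly ψ)}).topologicalClosure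

instance : CompleteSpace (H2 q α) := Submodule.topologicalClosure.completeSpace _

/-- The orthogonal projection `P_{q,α}` of `L²_{q,α}` onto `H²_{q,α}`. -/
def proj : L2 q α →L[ℂ] L2 q α := (H2 q α).starProjection

variable {q}

/-- The finite function `f ψ`, for `f ∈ D(U)_q` and `ψ ∈ ℂ[z]`, as a vector of `L²_{q,α}`. -/
def mulPoly (f : finiteFunctions q) (ψ : ℂ[X]) : L2 q α :=
  (PreL2.mk α ((f : FunU q) * poly ψ) (mul_mem_right f.2 _) : PreL2 q α)

/-- `A : ℂ[z] → ℂ[z]` is the Toeplitz-Bergman operator with the finite symbol `f`: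
`A ψ = P_{q,α}(f ψ)` for all polynomials `ψ`. -/
def IsToeplitzBergman (f : finiteFunctions q) (A : ℂ[X] →ₗ[ℂ] ℂ[X]) : Prop :=
  ∀ ψ : ℂ[X], Represents α (proj q α (mulPoly α f ψ)) (poly (A ψ))

end Hilbert

/-! ### The distributions `P_{z,mj}` -/

/-- The `q`-Pochhammer symbol `(a; b)_m = ∏_{i<m} (1 - a bⁱ)`. -/
def qPoch (a b : ℝ) (m : ℕ) : ℝ := ∏ i ∈ Finset.range m, (1 - a * b ^ i)

/-- The distribution
`P_{z,mj} = (q^{4α+2};q²)_m / (q²;q²)_m · q^{2j} z^j (1 - z z*)^{2α+1} z*^m`. -/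
def Pz (q α : ℝ) (m j : ℕ) : Module.End ℂ H :=
  ((qPoch (q ^ (4 * α + 2)) (q ^ 2) m / qPoch (q ^ 2) (q ^ 2) m * q ^ (2 * j) : ℝ) : ℂ) •
    (T q (zElt q) ^ j * yPow q ((2 * α + 1 : ℝ) : ℂ) * T q (zsElt q) ^ m)

end

end QuantumDisc

namespace QuantumDisc

noncomputable section

/-! Through `T` the problem becomes one about infinite matrices. Finite functions give all finite
matrices, and the scalar product of L² makes the matrix units orthogonal, `e_{ik}` having squared
norm (1 - q^{4α}) q^{4αk} wt(i)/wt(k). Since z^n shifts the basis by n, it is the orthogonal sum of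
the units on its diagonal, z^n = Σ_k e_{k+n,k}. Distinct powers live on distinct diagonals, so they
are orthogonal, and a case of the q-binomial theorem gives ‖z^n‖² = (q²;q²)_n / (q^{4α+2};q²)_n
(`hasSum_zNormSq`, `inner_zVec_zVec`).

A finite matrix meets only finitely many diagonals, so its projection to H² is the polynomial with
coefficients ⟨z^n, g⟩/‖z^n‖² (`exists_represents_proj`). A polynomial is determined by the vector it
represents, whence existence, uniqueness and linearity of the operator.

The matrix element is therefore ⟨z^m, f z^j⟩/‖z^m‖², a weighted sum of the entries (k+m, k+j) of `T
f` (`IsToeplitzBergman.coeff_eq`). The trace defining the integral of `P_{z,mj} f` is the same sum: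
its diagonal entry at k+j carries the same entry of `T f`, and the powers of q combine to q^{4αk}
(`nuInt_Pz_mul`). -/

/-! ### Matrix entries of the powers of z, z* and 1 - zz*. -/

theorem T_zElt_pow (q : ℝ) (n k : ℕ) : T q (zElt q ^ n) (v k) = v (k + n) := by
  induction n with
  | zero => simp
  | succ n ih => rw [pow_succ', map_mul, Module.End.mul_apply, ih, T_zElt, add_assoc]

theorem T_zsElt_pow_of_lt (q : ℝ) {n k : ℕ} (h : k < n) : T q (zsElt q ^ n) (v k) = 0 := by
  induction n generalizing k with
  | zero => omega
  | succ n ih =>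
    rw [pow_succ, map_mul, Module.End.mul_apply, T_zsElt, map_smul]
    rcases k with _ | k
    · simp
    · rw [Nat.add_sub_cancel, ih (by omega), smul_zero]

theorem star_zElt_pow (q : ℝ) (n : ℕ) : star (zElt q ^ n) = zsElt q ^ n := by
  rw [star_pow, star_zElt]

/-- As z*^n is adjoint to the shift z^n, its entries are ratios of the squared lengths `wt`; no
product of the factors 1 - q^{2j} has to be tracked. -/
theorem T_zsElt_pow_apply {q : ℝ} (hq : q ∈ Set.Ioo (0 : ℝ) 1) (n k : ℕ) (u : H) :
    T q (zsElt q ^ n) u k = (wt q (k + n) / wt q k : ℝ) * u (k + n) := by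
  have hw : ((wt q k : ℝ) : ℂ) ≠ 0 := by exact_mod_cast (wt_pos hq k).ne'
  have h := T_star q (zsElt q ^ n) (v k) u
  rw [← star_zElt_pow, star_star, T_zElt_pow, form_v_left, form_v_left, star_zElt_pow] at h
  rw [Complex.ofReal_div, div_mul_eq_mul_div, h, mul_div_cancel_left₀ _ hw]

theorem T_zsElt_pow {q : ℝ} (hq : q ∈ Set.Ioo (0 : ℝ) 1) (n k : ℕ) :
    T q (zsElt q ^ n) (v (k + n)) = ((wt q (k + n) / wt q k : ℝ) : ℂ) • v k := by
  ext i
  rw [T_zsElt_pow_apply hq]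
  by_cases h : i = k
  · subst h; simp [v]
  · have : i + n ≠ k + n := by omega
    simp [v, h]

theorem T_zElt_pow_apply (q : ℝ) (n k : ℕ) (u : H) :
    T q (zElt q ^ n) u (k + n) = u k := by
  have : (Finsupp.lapply (k + n) : H →ₗ[ℂ] ℂ) ∘ₗ T q (zElt q ^ n) = Finsupp.lapply k := by
    refine Finsupp.lhom_ext' fun j => LinearMap.ext_ring ?_
    change T q (zElt q ^ n) (v j) (k + n) = v j k
    rw [T_zElt_pow]
    simp [v, Finsupp.single_apply]
  exact LinearMap.congr_fun this u

theorem T_zElt_pow_apply_of_lt (q : ℝ) {n k : ℕ} (h : k < n) (u : H) :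
    T q (zElt q ^ n) u k = 0 := by
  have : (Finsupp.lapply k : H →ₗ[ℂ] ℂ) ∘ₗ T q (zElt q ^ n) = 0 := by
    refine Finsupp.lhom_ext' fun j => LinearMap.ext_ring ?_
    change T q (zElt q ^ n) (v j) k = 0
    rw [T_zElt_pow, v, Finsupp.single_apply, if_neg (by omega)]
  exact LinearMap.congr_fun this u

theorem yPow_apply (q : ℝ) (l : ℂ) (u : H) (k : ℕ) :
    yPow q l u k = (q : ℂ) ^ (2 * (k : ℂ) * l) * u k := by
  have : (Finsupp.lapply k : H →ₗ[ℂ] ℂ) ∘ₗ yPow q l =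
      (q : ℂ) ^ (2 * (k : ℂ) * l) • Finsupp.lapply k := by
    refine Finsupp.lhom_ext' fun j => LinearMap.ext_ring ?_
    change yPow q l (v j) k = (q : ℂ) ^ (2 * (k : ℂ) * l) * v j k
    rw [yPow, opOfBasis_v]
    by_cases h : j = k
    · subst h; simp [v]
    · simp [v, h]
  exact LinearMap.congr_fun this u

/-! ### Matrix units inside the ideal of finite functions. -/

/-- The finite function `f_{ij}` for which `T(f_{ij})` is a matrix unit. -/
def matrixUnit (q : ℝ) (i j : ℕ) : FunU q :=
  ((wt q j : ℂ)⁻¹) • (zElt q ^ i * f0Elt q * zsElt q ^ j)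

theorem matrixUnit_mem (q : ℝ) (i j : ℕ) : matrixUnit q i j ∈ finiteFunctions q :=
  Submodule.smul_mem _ _ (Submodule.subset_span ⟨_, _, rfl⟩)

/-- The power z*^j kills `v k` for k < j and sends it to a multiple of `v (k - j)` otherwise; f₀
keeps only k = j, where that multiple is `wt q j`, the constant divided out in `matrixUnit`. -/
theorem T_matrixUnit {q : ℝ} (hq : q ∈ Set.Ioo (0 : ℝ) 1) (i j k : ℕ) :
    T q (matrixUnit q i j) (v k) = if k = j then v i else 0 := by
  have hw : ((wt q j : ℝ) : ℂ) ≠ 0 := by exact_mod_cast (wt_pos hq j).ne'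
  rw [matrixUnit, map_smul, map_mul, map_mul, LinearMap.smul_apply, Module.End.mul_apply,
    Module.End.mul_apply]
  rcases lt_or_ge k j with h | h
  · rw [T_zsElt_pow_of_lt q h, if_neg h.ne]; simp
  · obtain ⟨l, rfl⟩ := Nat.exists_eq_add_of_le' h
    rw [T_zsElt_pow hq, map_smul, map_smul, T_f0Elt]
    by_cases hl : l = 0
    · subst hl
      have h0 : wt q 0 = 1 := by simp [wt]
      rw [if_pos rfl, if_pos (by omega), T_zElt_pow, zero_add, zero_add, h0, div_one,
        smul_smul, inv_mul_cancel₀ hw, one_smul]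
    · rw [if_neg hl, if_neg (by omega)]; simp

/-- `T` maps `D(U)_q` onto the operators with finitely many nonzero matrix entries. -/
theorem exists_finiteFunction {q : ℝ} (hq : q ∈ Set.Ioo (0 : ℝ) 1) (B : Module.End ℂ H)
    (hB : {k | B (v k) ≠ 0}.Finite) : ∃ g ∈ finiteFunctions q, T q g = B := by
  refine ⟨∑ k ∈ hB.toFinset, (B (v k)).sum fun i c => c • matrixUnit q i k,
    Submodule.sum_mem _ fun k _ => Submodule.sum_mem _ fun _ _ =>
      Submodule.smul_mem _ _ (matrixUnit_mem q _ k), op_ext fun l => ?_⟩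
  have h1 : ∀ k, T q ((B (v k)).sum fun i c => c • matrixUnit q i k) (v l) =
      if l = k then B (v k) else 0 := by
    intro k
    simp only [Finsupp.sum, map_sum, LinearMap.sum_apply, map_smul, LinearMap.smul_apply,
      T_matrixUnit hq]
    split_ifs with h
    · conv_rhs => rw [← Finsupp.sum_single (B (v k))]
      simp [Finsupp.sum, v]
    · simp
  rw [map_sum, LinearMap.sum_apply]
  simp only [h1, Finset.sum_ite_eq, Set.Finite.mem_toFinset, Set.mem_ofPred_eq]
  split_ifs with h
  · rfl
  · exact (not_not.1 h).symm

/-! ### A q-binomial sum and the norms of the powers of z. -/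

theorem qPoch_succ (a b : ℝ) (m : ℕ) : qPoch a b (m + 1) = qPoch a b m * (1 - a * b ^ m) :=
  Finset.prod_range_succ _ _

theorem qPoch_succ' (a b : ℝ) (m : ℕ) :
    qPoch a b (m + 1) = (1 - a) * qPoch (a * b) b m := by
  rw [qPoch, Finset.prod_range_succ', qPoch, pow_zero, mul_one, mul_comm]
  simp only [pow_succ', mul_assoc]

theorem qPoch_pos {a b : ℝ} (ha : a ∈ Set.Ico (0 : ℝ) 1) (hb : b ∈ Set.Icc (0 : ℝ) 1) (m : ℕ) :
    0 < qPoch a b m :=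
  Finset.prod_pos fun _ _ => sub_pos.2 <|
    (mul_le_of_le_one_right ha.1 (pow_le_one₀ hb.1 hb.2)).trans_lt ha.2

/-- A special case of the `q`-binomial theorem. -/
theorem hasSum_pow_mul_qPoch {x b : ℝ} (hx : x ∈ Set.Ico (0 : ℝ) 1) (hb : b ∈ Set.Ioo (0 : ℝ) 1)
    (n : ℕ) : HasSum (fun k : ℕ => x ^ k * qPoch (b ^ (k + 1)) b n)
      (qPoch b b n / qPoch x b (n + 1)) := by
  induction n generalizing x with
  | zero => simpa [qPoch] using hasSum_geometric_of_lt_one hx.1 hx.2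
  | succ n ih =>
    have hxb : x * b ∈ Set.Ico (0 : ℝ) 1 :=
      ⟨mul_nonneg hx.1 hb.1.le, (mul_le_of_le_one_right hx.1 hb.2.le).trans_lt hx.2⟩
    -- The new last factor is 1 - b^{n+1} b^k, so the sum splits into the previous one at x minus
    -- b^{n+1} times the previous one at xb.
    have h := (ih hx).sub ((ih hxb).mul_left (b ^ (n + 1)))
    convert h using 1
    · rfl
    · funext k
      rw [qPoch_succ, mul_pow]
      ring
    · have hp := (qPoch_pos hxb ⟨hb.1.le, hb.2.le⟩ n).ne'
      have h1 : 1 - x ≠ 0 := (sub_pos.2 hx.2).ne'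
      have hs : qPoch x b (n + 1 + 1) = qPoch x b (n + 1) * (1 - x * b ^ (n + 1)) :=
        qPoch_succ _ _ _
      have hs2 : qPoch (x * b) b (n + 1) = qPoch (x * b) b n * (1 - x * b ^ (n + 1)) := by
        rw [qPoch_succ, pow_succ']; ring
      have h2 : 1 - x * b ^ (n + 1) ≠ 0 := by
        intro h0
        rw [h0, mul_zero] at hs2
        exact (qPoch_pos hxb ⟨hb.1.le, hb.2.le⟩ (n + 1)).ne' hs2
      rw [hs, hs2, qPoch_succ' x, qPoch_succ b]
      field_simp
      ring

theorem wt_add (q : ℝ) (k n : ℕ) : wt q (k + n) = wt q k * qPoch ((q ^ 2) ^ (k + 1)) (q ^ 2) n := by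
  rw [wt, Finset.prod_range_add, wt, qPoch]
  congr 1
  exact Finset.prod_congr rfl fun i _ => by ring

/-- The squared norm of `z^n`. -/
def zNormSq (q α : ℝ) (n : ℕ) : ℝ :=
  qPoch (q ^ 2) (q ^ 2) n / qPoch (q ^ (4 * α + 2)) (q ^ 2) n

theorem zNormSq_pos {q α : ℝ} (hq : q ∈ Set.Ioo (0 : ℝ) 1) (hα : 0 < α) (n : ℕ) :
    0 < zNormSq q α n := by
  have h2 : q ^ 2 < 1 := pow_lt_one₀ hq.1.le hq.2 two_ne_zero
  have h3 : 0 ≤ q ^ 2 := sq_nonneg q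
  exact div_pos (qPoch_pos ⟨h3, h2⟩ ⟨h3, h2.le⟩ n) (qPoch_pos ⟨Real.rpow_nonneg hq.1.le _,
    Real.rpow_lt_one hq.1.le hq.2 (by positivity)⟩ ⟨h3, h2.le⟩ n)

/-- This is the q-binomial sum at x = q^{4α}, b = q²; the prefactor 1 - q^{4α} cancels the first
factor of (q^{4α};q²)_{n+1}. -/
theorem hasSum_zNormSq {q α : ℝ} (hq : q ∈ Set.Ioo (0 : ℝ) 1) (hα : 0 < α) (n : ℕ) :
    HasSum (fun k : ℕ => (1 - q ^ (4 * α)) * (q ^ (4 * α * k) / wt q k * wt q (k + n)))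
      (zNormSq q α n) := by
  have h2 : q ^ 2 < 1 := pow_lt_one₀ hq.1.le hq.2 two_ne_zero
  have hx : q ^ (4 * α) < 1 := Real.rpow_lt_one hq.1.le hq.2 (by positivity)
  have h := (hasSum_pow_mul_qPoch ⟨Real.rpow_nonneg hq.1.le (4 * α), hx⟩
    ⟨pow_pos hq.1 2, h2⟩ n).mul_left (1 - q ^ (4 * α))
  convert h using 1
  · rfl
  · funext k
    have := (wt_pos hq k).ne'
    rw [wt_add, Real.rpow_mul_natCast hq.1.le]
    field_simp
  · have e : q ^ (4 * α + 2) = q ^ (4 * α) * q ^ 2 := by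
      rw [Real.rpow_add hq.1, Real.rpow_two]
    have : 1 - q ^ (4 * α) ≠ 0 := (sub_pos.2 hx).ne'
    rw [zNormSq, qPoch_succ', e]
    field_simp

/-! ### Polynomials, and linearity of the pairing with a finite function. -/

theorem T_poly_v_zero {q : ℝ} (ψ : ℂ[X]) (n : ℕ) : T q (poly ψ) (v 0) n = ψ.coeff n := by
  induction ψ using Polynomial.induction_on' with
  | add a b h1 h2 =>
    rw [poly, map_add, map_add, LinearMap.add_apply, Finsupp.add_apply, coeff_add, ← h1, ← h2]
    rfl
  | monomial k c =>
    rw [poly, aeval_monomial, ← Algebra.smul_def, map_smul, LinearMap.smul_apply, T_zElt_pow,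
      coeff_monomial]
    simp [v, Finsupp.single_apply]

theorem poly_add {q : ℝ} (φ ψ : ℂ[X]) : (poly (φ + ψ) : FunU q) = poly φ + poly ψ := map_add _ _ _

theorem poly_smul {q : ℝ} (c : ℂ) (ψ : ℂ[X]) : (poly (c • ψ) : FunU q) = c • poly ψ := map_smul _ _ _

section Hilbert

variable {q : ℝ} (α : ℝ) [hq : Fact (q ∈ Set.Ioo (0 : ℝ) 1)]

/-- Here u need not be finite, so columns give no control. Instead the rows of g* vanish almost
everywhere, being adjoint to the columns of g. Finite support is what makes the `finsum` additive in
u. -/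
theorem finite_support_star_mul (g : PreL2 q α) (u : FunU q) :
    (Function.support fun k : ℕ =>
      ((q ^ (4 * α * k) : ℝ) : ℂ) * T q (star g.val * u) (v k) k).Finite := by
  refine (finite_of_mem hq.out (f := g.val) g.mem).subset fun k hk h0 => hk ?_
  have hw : ((wt q k : ℝ) : ℂ) ≠ 0 := by exact_mod_cast (wt_pos hq.out k).ne'
  have h := T_star q (star g.val) (v k) (T q u (v k))
  rw [star_star, h0, ← form_conj, form_zero_right, map_zero, form_v_left] at h
  have h2 : T q (star g.val) (T q u (v k)) k = 0 := (mul_eq_zero.1 h.symm).resolve_left hw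
  simp only [map_mul, Module.End.mul_apply, h2, mul_zero]

theorem nuAlphaInt_star_mul_add (g : PreL2 q α) (u w : FunU q) :
    nuAlphaInt q α (T q (star g.val * (u + w))) =
      nuAlphaInt q α (T q (star g.val * u)) + nuAlphaInt q α (T q (star g.val * w)) := by
  rw [nuAlphaInt_eq hq.out, nuAlphaInt_eq hq.out, nuAlphaInt_eq hq.out, ← mul_add,
    ← finsum_add_distrib (finite_support_star_mul α g u) (finite_support_star_mul α g w)]
  congr 1
  refine finsum_congr fun k => ?_
  rw [mul_add, map_add, LinearMap.add_apply, Finsupp.add_apply, mul_add]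

theorem nuAlphaInt_star_mul_smul (g : PreL2 q α) (c : ℂ) (u : FunU q) :
    nuAlphaInt q α (T q (star g.val * (c • u))) =
      c * nuAlphaInt q α (T q (star g.val * u)) := by
  rw [nuAlphaInt_eq hq.out, nuAlphaInt_eq hq.out, mul_left_comm,
    mul_finsum' _ c (finite_support_star_mul α g u)]
  congr 1
  refine finsum_congr fun k => ?_
  rw [mul_smul_comm, map_smul, LinearMap.smul_apply, Finsupp.smul_apply, smul_eq_mul,
    mul_left_comm]

/-! ### The integral of `P_{z,mj} f` as a trace. -/

theorem finsum_nat_eq_finsum_add {M : Type*} [AddCommMonoid M] {F : ℕ → M} {j : ℕ}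
    (h : ∀ l < j, F l = 0) : ∑ᶠ l, F l = ∑ᶠ k, F (k + j) := by
  rw [← finsum_mem_range (f := F) (add_left_injective j), finsum_mem_def]
  refine finsum_congr fun l => (Set.indicator_apply_eq_self.2 fun hl => h l ?_).symm
  by_contra hlj
  exact hl ⟨l - j, Nat.sub_add_cancel (not_lt.1 hlj)⟩

theorem nuInt_Pz_mul (f : FunU q) (m j : ℕ) :
    nuInt q (Pz q α m j * T q f) = ((1 - q ^ 2 : ℝ) : ℂ) * ((zNormSq q α m : ℂ)⁻¹ *
      ∑ᶠ k : ℕ, ((q ^ (4 * α * k) / wt q k * wt q (k + m) : ℝ) : ℂ) *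
        T q f (v (k + j)) (k + m)) := by
  have hP : ∀ u : H, (Pz q α m j * T q f) u =
      (((zNormSq q α m)⁻¹ * q ^ (2 * j) : ℝ) : ℂ) • T q (zElt q ^ j)
        (yPow q ((2 * α + 1 : ℝ) : ℂ) (T q (zsElt q ^ m) (T q f u))) := fun u => by
    rw [zNormSq, inv_div, map_pow, map_pow]
    rfl
  -- The image of z^j has no components below j, so the trace may start at index j.
  rw [nuInt, tr, finsum_nat_eq_finsum_add (j := j)]
  · have h1 : (1 - (q : ℂ) ^ 2) = ((1 - q ^ 2 : ℝ) : ℂ) := by push_cast; rfl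
    rw [h1, ← smul_eq_mul (zNormSq q α m : ℂ)⁻¹, smul_finsum]
    congr 1
    refine finsum_congr fun k => ?_
    have h2 : (q : ℂ) ^ (2 * ((k + j : ℕ) : ℂ) * -1) =
        ((q ^ (2 * ((k + j : ℕ) : ℝ) * -1) : ℝ) : ℂ) := by
      rw [Complex.ofReal_cpow hq.out.1.le]; push_cast; rfl
    have h3 : (q : ℂ) ^ (2 * (k : ℂ) * ((2 * α + 1 : ℝ) : ℂ)) =
        ((q ^ (2 * (k : ℝ) * (2 * α + 1)) : ℝ) : ℂ) := by
      rw [Complex.ofReal_cpow hq.out.1.le]; push_cast; rfl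
    -- The factor q^{2j} in `Pz` compensates the shift by j in (1 - zz*)⁻¹, taken at k + j, whereas
    -- (1 - zz*)^{2α+1} acts at k.
    have h4 : q ^ (4 * α * k) =
        q ^ (2 * ((k + j : ℕ) : ℝ) * -1) * q ^ (2 * j) * q ^ (2 * (k : ℝ) * (2 * α + 1)) := by
      rw [← Real.rpow_natCast, ← Real.rpow_add hq.out.1, ← Real.rpow_add hq.out.1]
      congr 1
      push_cast
      ring
    rw [Module.End.mul_apply, yPow, opOfBasis_v, map_smul, Finsupp.smul_apply, hP,
      Finsupp.smul_apply, T_zElt_pow_apply, yPow_apply, T_zsElt_pow_apply hq.out, h2, h3, h4]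
    simp only [smul_eq_mul]
    push_cast
    ring
  · intro l hl
    rw [Module.End.mul_apply, hP, Finsupp.smul_apply, T_zElt_pow_apply_of_lt q hl, smul_zero]

/-- Left multiplication creates no new nonzero columns, and each column lies in `H`, hence is
finite. -/
theorem finite_Pz_mul (f : finiteFunctions q) (m j : ℕ) :
    ∃ g ∈ finiteFunctions q, T q g = Pz q α m j * T q (f : FunU q) := by
  refine exists_finiteFunction hq.out _ ((finite_of_mem hq.out f.2).subset fun k hk h0 => hk ?_)
  rw [Module.End.mul_apply, h0, map_zero]

/-! ### Matrix units in L² and uniqueness of represented functions. -/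

variable {α}

/-- Matrix units as vectors of the pre-Hilbert space. -/
def unitVec (q α : ℝ) (i j : ℕ) : PreL2 q α := PreL2.mk α (matrixUnit q i j) (matrixUnit_mem q i j)

theorem nuAlphaInt_star_unitVec (i j : ℕ) (u : FunU q) :
    nuAlphaInt q α (T q (star (unitVec q α i j).val * u)) =
      (((1 - q ^ (4 * α)) * (q ^ (4 * α * j) / wt q j * wt q i) : ℝ) : ℂ) * T q u (v j) i := by
  have hv : ∀ k, T q (unitVec q α i j).val (v k) = if k = j then v i else 0 :=
    T_matrixUnit hq.out i j
  rw [nuAlphaInt_star_mul hq.out, finsum_eq_single _ j]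
  · rw [hv, if_pos rfl, form_v_left]
    push_cast
    ring
  · intro k hk
    rw [hv, if_neg hk, ← form_conj, form_zero_right, map_zero, mul_zero]

variable [hα : Fact (0 < α)]

theorem inner_coe_coe (g h : PreL2 q α) :
    inner ℂ (g : L2 q α) (h : L2 q α) = nuAlphaInt q α (T q (star g.val * h.val)) :=
  UniformSpace.Completion.inner_coe g h

theorem Represents.add {F G : L2 q α} {u w : FunU q} (h1 : Represents α F u)
    (h2 : Represents α G w) : Represents α (F + G) (u + w) := fun g => by
  rw [inner_add_right, h1, h2, nuAlphaInt_star_mul_add]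

theorem Represents.smul {F : L2 q α} {u : FunU q} (c : ℂ) (h : Represents α F u) :
    Represents α (c • F) (c • u) := fun g => by
  rw [inner_smul_right, h, nuAlphaInt_star_mul_smul]

theorem Represents.unique_left {F G : L2 q α} {u : FunU q} (h1 : Represents α F u)
    (h2 : Represents α G u) : F = G :=
  UniformSpace.Completion.denseRange_coe.eq_of_inner_right ℂ fun g => by rw [h1, h2]

theorem one_sub_rpow_pos : 0 < 1 - q ^ (4 * α) :=
  sub_pos.2 (Real.rpow_lt_one hq.out.1.le hq.out.2 (by have := hα.out; positivity))

theorem unit_weight_pos (i j : ℕ) :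
    0 < (1 - q ^ (4 * α)) * (q ^ (4 * α * j) / wt q j * wt q i) :=
  mul_pos one_sub_rpow_pos (mul_pos (div_pos (Real.rpow_pos_of_pos hq.out.1 _)
    (wt_pos hq.out j)) (wt_pos hq.out i))

/-- Pairing with the unit in position (n, 0) reads off the n-th entry of ψ(z)v₀, which is the n-th
coefficient of ψ. -/
theorem Represents.unique_right {F : L2 q α} {φ ψ : ℂ[X]} (h1 : Represents α F (poly φ))
    (h2 : Represents α F (poly ψ)) : φ = ψ := by
  ext n
  have h := (h1 (unitVec q α n 0)).symm.trans (h2 (unitVec q α n 0))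
  rw [nuAlphaInt_star_unitVec, nuAlphaInt_star_unitVec, T_poly_v_zero, T_poly_v_zero] at h
  exact mul_left_cancel₀ (by exact_mod_cast (unit_weight_pos n 0).ne') h

theorem inner_unitVec (i j k l : ℕ) :
    inner ℂ (unitVec q α i j : L2 q α) (unitVec q α k l : L2 q α) =
      if i = k ∧ j = l then
        (((1 - q ^ (4 * α)) * (q ^ (4 * α * j) / wt q j * wt q i) : ℝ) : ℂ) else 0 := by
  rw [inner_coe_coe, nuAlphaInt_star_unitVec]
  have hv : T q (unitVec q α k l).val (v j) = if j = l then v k else 0 :=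
    T_matrixUnit hq.out k l j
  rw [hv]
  by_cases h1 : j = l
  · by_cases h2 : i = k
    · simp [h1, h2, v]
    · simp [h2, v, h1]
  · simp [h1]

/-- The vectors need not be normalised: the criterion for orthogonal families of subspaces is
applied to the lines they span. -/
theorem summable_of_orthogonal {E : Type*} [NormedAddCommGroup E] [InnerProductSpace ℂ E]
    [CompleteSpace E] {ι : Type*} {x : ι → E} (hx : Pairwise fun i j => inner ℂ (x i) (x j) = 0)
    (hs : Summable fun i => ‖x i‖ ^ 2) : Summable x := by
  have hV : OrthogonalFamily ℂ (fun i => Submodule.span ℂ {x i})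
      (fun i => (Submodule.span ℂ {x i}).subtypeₗᵢ) :=
    OrthogonalFamily.of_pairwise fun i j h => by
      refine Submodule.isOrtho_span.2 fun a ha b hb => ?_
      rw [Set.mem_singleton_iff.1 ha, Set.mem_singleton_iff.1 hb]
      exact hx h
  exact (hV.summable_iff_norm_sq_summable
    (fun i => ⟨x i, Submodule.mem_span_singleton_self _⟩)).2 hs

theorem summable_unitVec (n : ℕ) :
    Summable fun k : ℕ => (unitVec q α (k + n) k : L2 q α) := by
  refine summable_of_orthogonal (fun i j h => ?_) ?_
  · beta_reduce
    rw [inner_unitVec, if_neg fun hh => h hh.2]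
  · refine (hasSum_zNormSq hq.out hα.out n).summable.congr fun k => ?_
    rw [@norm_sq_eq_re_inner ℂ, inner_unitVec, if_pos ⟨rfl, rfl⟩, RCLike.re_to_complex,
      Complex.ofReal_re]

/-! ### The powers of z as vectors of L². -/

variable (q α)

/-- The power `z^n` as a vector of `L²_{q,α}`. -/
def zVec (n : ℕ) : L2 q α := ∑' k : ℕ, (unitVec q α (k + n) k : L2 q α)

variable {q α}

theorem hasSum_zVec (n : ℕ) :
    HasSum (fun k : ℕ => (unitVec q α (k + n) k : L2 q α)) (zVec q α n) :=
  (summable_unitVec n).hasSum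

theorem represents_zVec (n : ℕ) : Represents α (zVec q α n) (zElt q ^ n) := fun g => by
  have h := (innerSL ℂ (g : L2 q α)).hasSum (hasSum_zVec (q := q) (α := α) n)
  simp only [innerSL_apply_apply] at h
  have hterm : ∀ k : ℕ, inner ℂ (g : L2 q α) (unitVec q α (k + n) k : L2 q α) =
      ((1 - q ^ (4 * α) : ℝ) : ℂ) * (((q ^ (4 * α * k) / wt q k : ℝ) : ℂ) *
        form q (T q g.val (v k)) (T q (zElt q ^ n) (v k))) := fun k => by
    rw [← inner_conj_symm, inner_coe_coe, nuAlphaInt_star_unitVec, T_zElt_pow, ← form_conj,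
      form_v_left, map_mul, map_mul, Complex.conj_ofReal, Complex.conj_ofReal]
    push_cast
    ring
  have hfin : (Function.support fun k : ℕ => ((q ^ (4 * α * k) / wt q k : ℝ) : ℂ) *
      form q (T q g.val (v k)) (T q (zElt q ^ n) (v k))).Finite := by
    refine (finite_of_mem hq.out (f := g.val) g.mem).subset fun k hk h0 => hk ?_
    simp only [h0, ← form_conj q _ (0 : H), form_zero_right, map_zero, mul_zero]
  -- A finite g pairs to zero with almost all terms of the series, so the Hilbert space sum agrees
  -- with the `finsum` in the integral.
  rw [nuAlphaInt_star_mul hq.out, ← tsum_eq_finsum (L := SummationFilter.unconditional ℕ) hfin,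
    ← tsum_mul_left, ← h.tsum_eq]
  exact tsum_congr hterm

theorem inner_zVec_coe (n : ℕ) (g : PreL2 q α) :
    inner ℂ (zVec q α n) (g : L2 q α) = ((1 - q ^ (4 * α) : ℝ) : ℂ) *
      ∑ᶠ k : ℕ, ((q ^ (4 * α * k) / wt q k * wt q (k + n) : ℝ) : ℂ) *
        T q g.val (v k) (k + n) := by
  rw [← inner_conj_symm, represents_zVec, nuAlphaInt_star_mul hq.out, map_mul,
    Complex.conj_ofReal, conj_finsum]
  congr 1
  refine finsum_congr fun k => ?_
  rw [map_mul, Complex.conj_ofReal, form_conj, T_zElt_pow, form_v_left]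
  push_cast
  ring

/-- The vector z^m sees only the m-th diagonal below the main one, which yields orthogonality of
distinct powers term by term. -/
theorem inner_zVec_unitVec (m n k : ℕ) :
    inner ℂ (zVec q α m) (unitVec q α (k + n) k : L2 q α) = if m = n then
      (((1 - q ^ (4 * α)) * (q ^ (4 * α * k) / wt q k * wt q (k + n)) : ℝ) : ℂ) else 0 := by
  have hv : ∀ l, T q (unitVec q α (k + n) k).val (v l) = if l = k then v (k + n) else 0 :=
    T_matrixUnit hq.out _ k
  rw [inner_zVec_coe, finsum_eq_single _ k]
  · rw [hv, if_pos rfl]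
    by_cases h : m = n
    · subst h; simp [v]
    · simp [v, h]
  · intro l hl
    rw [hv, if_neg hl, Finsupp.zero_apply, mul_zero]

theorem inner_zVec_zVec (m n : ℕ) :
    inner ℂ (zVec q α m) (zVec q α n) = if m = n then (zNormSq q α n : ℂ) else 0 := by
  have h := (innerSL ℂ (zVec q α m)).hasSum (hasSum_zVec (q := q) (α := α) n)
  simp only [innerSL_apply_apply, inner_zVec_unitVec] at h
  refine h.unique ?_
  split_ifs
  · exact Complex.hasSum_ofReal.2 (hasSum_zNormSq hq.out hα.out n)
  · exact hasSum_zero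

theorem represents_sum {ι : Type*} (s : Finset ι) {F : ι → L2 q α} {u : ι → FunU q}
    (h : ∀ i ∈ s, Represents α (F i) (u i)) : Represents α (∑ i ∈ s, F i) (∑ i ∈ s, u i) := by
  classical
  induction s using Finset.induction_on with
  | empty =>
    -- That 0 represents 0 is obtained by scaling z⁰ by 0.
    have h0 := (represents_zVec (q := q) (α := α) 0).smul 0
    rwa [zero_smul, zero_smul] at h0
  | insert i s hi ih =>
    rw [Finset.sum_insert hi, Finset.sum_insert hi]
    exact (h i (Finset.mem_insert_self _ _)).add
      (ih fun j hj => h j (Finset.mem_insert_of_mem hj))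

theorem represents_polynomial (ψ : ℂ[X]) :
    Represents α (∑ n ∈ ψ.support, ψ.coeff n • zVec q α n) (poly ψ) := by
  rw [poly, aeval_def, eval₂_eq_sum, Polynomial.sum]
  simp only [← Algebra.smul_def]
  exact represents_sum _ fun n _ => (represents_zVec n).smul _

theorem Represents.inner_zVec {F : L2 q α} {ψ : ℂ[X]} (h : Represents α F (poly ψ)) (m : ℕ) :
    inner ℂ (zVec q α m) F = ψ.coeff m * zNormSq q α m := by
  rw [h.unique_left (represents_polynomial ψ), inner_sum]
  simp only [inner_smul_right, inner_zVec_zVec, mul_ite, mul_zero, Finset.sum_ite_eq,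
    mem_support_iff, ne_eq, ite_not]
  split_ifs with h0
  · rw [h0, zero_mul]
  · rfl

/-! ### The projection onto H² of a finite function. -/

theorem zVec_mem_H2 (n : ℕ) : zVec q α n ∈ H2 q α := by
  refine Submodule.le_topologicalClosure _ (Submodule.subset_span ⟨X ^ n, ?_⟩)
  rw [poly, map_pow, aeval_X]
  exact represents_zVec n

theorem inner_eq_zero_of_mem_H2 {x : L2 q α} (hx : ∀ n, inner ℂ (zVec q α n) x = 0)
    {y : L2 q α} (hy : y ∈ H2 q α) : inner ℂ y x = 0 := by
  -- The orthogonal complement of x is closed, so it is enough to test polynomials, which are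
  -- combinations of the z^n.
  have hle : H2 q α ≤ (Submodule.span ℂ {x})ᗮ := by
    refine Submodule.topologicalClosure_minimal _ (Submodule.span_le.2 ?_)
      (Submodule.isClosed_orthogonal _)
    rintro F ⟨ψ, hψ⟩
    rw [SetLike.mem_coe, Submodule.mem_orthogonal_singleton_iff_inner_left,
      hψ.unique_left (represents_polynomial ψ), sum_inner]
    exact Finset.sum_eq_zero fun n _ => by rw [inner_smul_left, hx, mul_zero]
  exact Submodule.mem_orthogonal_singleton_iff_inner_left.1 (hle hy)

/-- The pairing with z^n involves only the entries (k+n, k) of g, and a finite matrix has none once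
n exceeds all its row indices. This makes the projection a polynomial rather than an infinite
series. -/
theorem exists_inner_zVec_eq_zero (g : PreL2 q α) :
    ∃ M : ℕ, ∀ n, M ≤ n → inner ℂ (zVec q α n) (g : L2 q α) = 0 := by
  have hfin := finite_of_mem hq.out (f := g.val) g.mem
  obtain ⟨M, hM⟩ :=
    (hfin.toFinset.biUnion fun k => (T q g.val (v k)).support).exists_nat_subset_range
  refine ⟨M, fun n hn => ?_⟩
  rw [inner_zVec_coe, finsum_eq_zero_of_forall_eq_zero, mul_zero]
  intro k
  have : T q g.val (v k) (k + n) = 0 := by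
    by_contra h
    have h1 := hM (Finset.mem_biUnion.2 ⟨k, hfin.mem_toFinset.2 fun h0 => h (by simp [h0]),
      Finsupp.mem_support_iff.2 h⟩)
    have := Finset.mem_range.1 h1
    omega
  rw [this, mul_zero]

theorem exists_represents_proj (g : PreL2 q α) :
    ∃ φ : ℂ[X], Represents α (proj q α (g : L2 q α)) (poly φ) := by
  obtain ⟨M, hM⟩ := exists_inner_zVec_eq_zero g
  have hN : ∀ n, (zNormSq q α n : ℂ) ≠ 0 := fun n => by
    exact_mod_cast (zNormSq_pos hq.out hα.out n).ne'
  -- Fourier coefficients with respect to the orthogonal, not normalised, system z^n.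
  let c : ℕ → ℂ := fun n => inner ℂ (zVec q α n) (g : L2 q α) / zNormSq q α n
  let φ : ℂ[X] := ∑ n ∈ Finset.range M, monomial n (c n)
  have hφ : ∀ n, φ.coeff n = c n := fun n => by
    simp only [φ, finsetSum_coeff, coeff_monomial, Finset.sum_ite_eq', Finset.mem_range]
    split_ifs with h
    · rfl
    · simp only [c, hM n (not_lt.1 h), zero_div]
  have hr := represents_polynomial (q := q) (α := α) φ
  set G := ∑ n ∈ φ.support, φ.coeff n • zVec q α n
  have hG : G ∈ H2 q α := Submodule.sum_mem _ fun n _ => Submodule.smul_mem _ _ (zVec_mem_H2 n)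
  refine ⟨φ, ?_⟩
  have : proj q α (g : L2 q α) = G := by
    refine Submodule.eq_starProjection_of_mem_of_inner_eq_zero hG fun w hw => ?_
    rw [← inner_conj_symm, inner_eq_zero_of_mem_H2 (fun n => ?_) hw, map_zero]
    rw [inner_sub_right, hr.inner_zVec, hφ, div_mul_cancel₀ _ (hN n), sub_self]
  rwa [this]

theorem inner_zVec_proj (n : ℕ) (x : L2 q α) :
    inner ℂ (zVec q α n) (proj q α x) = inner ℂ (zVec q α n) x := by
  rw [proj, ← Submodule.inner_starProjection_left_eq_right,
    Submodule.starProjection_eq_self_iff.2 (zVec_mem_H2 n)]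

/-! ### The Toeplitz–Bergman operator and its matrix elements. -/

theorem mulPoly_add (f : finiteFunctions q) (φ ψ : ℂ[X]) :
    mulPoly α f (φ + ψ) = mulPoly α f φ + mulPoly α f ψ := by
  rw [mulPoly, mulPoly, mulPoly, ← UniformSpace.Completion.coe_add]
  congr 1
  refine Subtype.ext ?_
  change (f : FunU q) * poly (φ + ψ) =
    (f : FunU q) * poly φ + (f : FunU q) * poly ψ
  rw [poly, map_add, mul_add]
  rfl

theorem mulPoly_smul (f : finiteFunctions q) (c : ℂ) (ψ : ℂ[X]) :
    mulPoly α f (c • ψ) = c • mulPoly α f ψ := by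
  rw [mulPoly, mulPoly, ← UniformSpace.Completion.coe_smul]
  congr 1
  refine Subtype.ext ?_
  change (f : FunU q) * poly (c • ψ) = c • ((f : FunU q) * poly ψ)
  rw [poly, map_smul, mul_smul_comm]
  rfl

/-- The values are chosen separately for each ψ; linearity then follows because a vector represents
at most one polynomial. -/
theorem existsUnique_toeplitzBergman (f : finiteFunctions q) :
    ∃! A : ℂ[X] →ₗ[ℂ] ℂ[X], IsToeplitzBergman α f A := by
  choose A hA using fun ψ : ℂ[X] => exists_represents_proj
    (PreL2.mk α ((f : FunU q) * poly ψ) (mul_mem_right f.2 _))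
  have hA' : ∀ ψ, Represents α (proj q α (mulPoly α f ψ)) (poly (A ψ)) := hA
  refine ⟨{ toFun := A, map_add' := fun φ ψ => ?_, map_smul' := fun c ψ => ?_ }, hA',
    fun B hB => LinearMap.ext fun ψ => (hB ψ).unique_right (hA' ψ)⟩
  · have h := hA' (φ + ψ)
    rw [mulPoly_add, map_add] at h
    refine h.unique_right ?_
    rw [poly_add]
    exact (hA' φ).add (hA' ψ)
  · have h := hA' (c • ψ)
    rw [mulPoly_smul, map_smul] at h
    refine h.unique_right ?_
    rw [RingHom.id_apply, poly_smul]
    exact (hA' ψ).smul c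

/-- Pairing with z^m ignores the projection and isolates the m-th coefficient times ‖z^m‖²; right
multiplication of f by z^j shifts its columns by j. -/
theorem IsToeplitzBergman.coeff_eq {f : finiteFunctions q} {A : ℂ[X] →ₗ[ℂ] ℂ[X]}
    (hA : IsToeplitzBergman α f A) (m j : ℕ) :
    (A (X ^ j)).coeff m = (zNormSq q α m : ℂ)⁻¹ * (((1 - q ^ (4 * α) : ℝ) : ℂ) *
      ∑ᶠ k : ℕ, ((q ^ (4 * α * k) / wt q k * wt q (k + m) : ℝ) : ℂ) *
        T q (f : FunU q) (v (k + j)) (k + m)) := by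
  have hN : (zNormSq q α m : ℂ) ≠ 0 := by
    exact_mod_cast (zNormSq_pos hq.out hα.out m).ne'
  have h := (hA (X ^ j)).inner_zVec m
  rw [inner_zVec_proj, mulPoly, inner_zVec_coe] at h
  rw [eq_inv_mul_iff_mul_eq₀ hN, mul_comm, ← h]
  congr 1
  refine finsum_congr fun k => ?_
  change _ * T q ((f : FunU q) * poly (X ^ j)) (v k) (k + m) = _
  rw [poly, map_pow, aeval_X, map_mul, Module.End.mul_apply, T_zElt_pow]

end Hilbert

end

end QuantumDisc

/-- Let `0 < q < 1`, `α > 0` and let `f` be a finite function in the quantum disc. There is exactly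
one linear operator in `ℂ[z]` that is the Toeplitz-Bergman operator with symbol `f`, the products
`P_{z,mj} f` are finite functions, and the matrix elements of the operator are
`(1 - q^{4α})/(1 - q²) ∫ P_{z,mj} f dν`. -/
theorem proposition1p5 (q α : ℝ) [Fact (q ∈ Set.Ioo (0 : ℝ) 1)] [Fact (0 < α)]
    (f : QuantumDisc.finiteFunctions q) :
    (∃! A : ℂ[X] →ₗ[ℂ] ℂ[X], QuantumDisc.IsToeplitzBergman α f A) ∧
    ∀ A : ℂ[X] →ₗ[ℂ] ℂ[X], QuantumDisc.IsToeplitzBergman α f A → ∀ m j : ℕ,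
      (∃ g ∈ QuantumDisc.finiteFunctions q,
        QuantumDisc.T q g = QuantumDisc.Pz q α m j * QuantumDisc.T q (f : QuantumDisc.FunU q)) ∧
      (A (X ^ j)).coeff m = (((1 - q ^ (4 * α)) / (1 - q ^ 2) : ℝ) : ℂ) *
        QuantumDisc.nuInt q
          (QuantumDisc.Pz q α m j * QuantumDisc.T q (f : QuantumDisc.FunU q)) := by
  refine ⟨QuantumDisc.existsUnique_toeplitzBergman f, fun A hA m j =>
    ⟨QuantumDisc.finite_Pz_mul α f m j, ?_⟩⟩
  have hq : q ∈ Set.Ioo (0 : ℝ) 1 := Fact.out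
  have h : ((1 - q ^ 2 : ℝ) : ℂ) ≠ 0 := by
    exact_mod_cast (sub_pos.2 (pow_lt_one₀ hq.1.le hq.2 two_ne_zero)).ne'
  rw [hA.coeff_eq, QuantumDisc.nuInt_Pz_mul, mul_left_comm, Complex.ofReal_div, ← mul_assoc (_ / _),
    div_mul_cancel₀ _ h, mul_left_comm]
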